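/- **Setting.** Let $(\mathcal X,\mathcal F_{\mathcal X})$, $(\Phi,\mathcal F_\Phi)$ and $(\mathcal I,\mathcal F_{\mathcal I})$ be measurable spaces and let $\mathcal Y=\mathcal X\times\Phi$ carry the product $\sigma$-algebra together with a Polish topology whose open sets are measurable (for instance $\mathcal X,\Phi$ Polish with their Borel $\sigma$-algebras and the product topology). Let $\nu$ be a probability measure on $\mathcal X$, and let $(y,\gamma,B)\mapsto P_\gamma(y,B)$ be a Markov transition kernel from $\mathcal Y\times\mathcal I$ to $\mathcal Y$. For each $\gamma\in\mathcal I$ let $\pi_\gamma$ be a probability measure on $\mathcal Y$ that is invariant for $P_\gamma$ and has first marginal $\nu$, i.e. $\pi_\gamma(B\times\Phi)=\nu(B)$ for all measurable $B\subseteq\mathcal X$. **AIR chain.** Let $\beta\ge 1$, $k_j=\lceil j^\beta\rceil$, $T_0=0$ and $T_m=\sum_{j=1}^m k_j$. Let $(Y_n,\Gamma_n)_{n\ge 0}$ be $\mathcal Y\times\mathcal I$-valued random variables on a probability space $(\Omega,\mathcal F,\mathbb P)$, and let $\mathcal F_n=\sigma(Y_0,\dots,Y_n,\Gamma_0,\dots,\Gamma_n)$.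 Assume that * $(Y_0,\Gamma_0)\equiv(y_0,\gamma_0)$ for some fixed $y_0\in\mathcal Y$, $\gamma_0\in\mathcal I$; * for all $n\ge0$ and measurable $B\subseteq\mathcal Y$, $\mathbb P[Y_{n+1}\in B\mid\mathcal F_n]=P_{\Gamma_n}(Y_n,B)$ almost surely; * for all $n\ge0$, $\Gamma_n=U_n(Y_0,\dots,Y_n,\Gamma_0,\dots,\Gamma_{n-1})$ for some measurable map $U_n:\mathcal Y^{n+1}\times\mathcal I^n\to\mathcal I$; * $\Gamma_{i_1}=\Gamma_{i_2}$ whenever $i_1,i_2\in\{T_j,\dots,T_{j+1}-1\}$ for some $j\ge0$. Write $X_n$ for the $\mathcal X$-component of $Y_n$. **Contraction.** Let $d:\mathcal Y\times\mathcal Y\to[0,\infty)$ be distance-like: symmetric, with $d(x,y)=0$ if and only if $x=y$, and lower semicontinuous for the product topology on $\mathcal Y\times\mathcal Y$. For probability measures $\mu_1,\mu_2$ on $\mathcal Y$ put $\mathcal W(\mu_1,\mu_2)=\inf_\xi\int d(x,y)\,\xi(\mathrm dx,\mathrm dy)$, the infimum over all couplings $\xi$ of $\mu_1,\mu_2$.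 For a Markov kernel $Q$ on $\mathcal Y$ put $$\tau(Q)=\sup_{y_1\ne y_2}\frac{\mathcal W(Q(y_1,\cdot),Q(y_2,\cdot))}{d(y_1,y_2)},$$ and let $E_\gamma(y)=\int_{\mathcal Y}d(y,y')\,\pi_\gamma(\mathrm dy')$. Assume that there are $M\in[1,\infty)$, $\tau\in[0,1)$, an integer $k_0\ge1$ and $K\in(0,\infty)$ with $$\tau(P_\gamma)\le M,\qquad \tau(P_\gamma^{k_0})\le\tau,\qquad E_\gamma(y)\le K\qquad\text{for all }\gamma\in\mathcal I,\ y\in\mathcal Y.$$ **Theorem.** Let $f:\mathcal X\to\mathbb R$ be measurable and such that $h:\mathcal Y\to\mathbb R$, $h(x,\phi)=f(x)$, is bounded and satisfies $|h(y)-h(y')|\le L\,d(y,y')$ for all $y,y'\in\mathcal Y$, with some $L\in(0,\infty)$. Then for every $\varepsilon>0$, almost surely, $$\lim_{n\to\infty}\frac{1}{\sqrt n\,(\log n)^{1/2+\varepsilon}}\sum_{j=1}^n\bigl(f(X_j)-\nu(f)\bigr)=0,\qquad \nu(f)=\int_{\mathcal X}f\,\mathrm d\nu.$$ -/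

import Mathlib

open MeasureTheory ProbabilityTheory Filter Topology
open scoped NNReal ENNReal

namespace AIRMCMC

section Distance

variable {A : Type*}

/-- A distance-like function: symmetric, vanishing exactly on the diagonal, and lower
semicontinuous for the product topology. -/
structure IsDistanceLike [TopologicalSpace A] (d : A → A → ℝ≥0) : Prop where
  symm : ∀ x y, d x y = d y x
  eq_zero_iff : ∀ x y, d x y = 0 ↔ x = y
  lowerSemicontinuous : LowerSemicontinuous (fun p : A × A => d p.1 p.2)

/-- `ψ` is Lipschitz with constant `L` with respect to `d`. -/
def IsLipschitzWrt (d : A → A → ℝ≥0) (L : ℝ) (ψ : A → ℝ) : Prop :=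
  ∀ x y, |ψ x - ψ y| ≤ L * (d x y : ℝ)

variable [MeasurableSpace A]

/-- The set of couplings of `μ₁` and `μ₂`: measures on the product with these marginals. -/
def couplings (μ₁ μ₂ : Measure A) : Set (Measure (A × A)) :=
  {ξ | ξ.map Prod.fst = μ₁ ∧ ξ.map Prod.snd = μ₂}

/-- The Wasserstein-like function of `d`. -/
noncomputable def wasserstein (d : A → A → ℝ≥0) (μ₁ μ₂ : Measure A) : ℝ≥0∞ :=
  ⨅ ξ ∈ couplings μ₁ μ₂, ∫⁻ p, (d p.1 p.2 : ℝ≥0∞) ∂ξ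

/-- The Wasserstein contraction coefficient of a kernel; an extended nonnegative number. -/
noncomputable def contractionCoeff (d : A → A → ℝ≥0) (κ : Kernel A A) : ℝ≥0∞ :=
  ⨆ (y₁ : A) (y₂ : A) (_ : y₁ ≠ y₂), wasserstein d (κ y₁) (κ y₂) / (d y₁ y₂ : ℝ≥0∞)

/-- The eccentricity of the point `y` with respect to the measure `π`. -/
noncomputable def eccentricity (d : A → A → ℝ≥0) (π : Measure A) (y : A) : ℝ≥0∞ :=
  ∫⁻ y', (d y y' : ℝ≥0∞) ∂π

end Distance

/-- The window lengths `k_j = ⌈j ^ β⌉`. -/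
noncomputable def windowLength (β : ℝ) (j : ℕ) : ℕ := ⌈(j : ℝ) ^ β⌉₊

/-- The adaptation times `T_m = k_1 + ⋯ + k_m`; in particular `T_0 = 0`. -/
noncomputable def adaptTime (β : ℝ) (m : ℕ) : ℕ := ∑ j ∈ Finset.Icc 1 m, windowLength β j

section Chain

variable {Ω 𝓨 I : Type*} [MeasurableSpace 𝓨] [MeasurableSpace I]

/-- The σ-algebra generated by `Y_0, …, Y_n, Γ_0, …, Γ_n`. -/
@[reducible] def history (Y : ℕ → Ω → 𝓨) (Γ : ℕ → Ω → I) (n : ℕ) : MeasurableSpace Ω :=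
  ⨆ j ≤ n, (MeasurableSpace.comap (Y j) inferInstance ⊔ MeasurableSpace.comap (Γ j) inferInstance)

variable [MeasurableSpace Ω]

/-- `(Y_n, Γ_n)` is an AIR adaptive chain on `(Ω, μ)` with parameter `β`, started at
`(y₀, γ₀)`. The transition kernels `P_γ` are the sections of the kernel `P`, that is
`P_γ(y, B) = P (y, γ) B`. -/
structure IsAIRChain (μ : Measure Ω) (P : Kernel (𝓨 × I) 𝓨) (β : ℝ) (y₀ : 𝓨) (γ₀ : I)
    (Y : ℕ → Ω → 𝓨) (Γ : ℕ → Ω → I) : Prop where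
  measurable_state : ∀ n, Measurable (Y n)
  measurable_param : ∀ n, Measurable (Γ n)
  init_state : ∀ ω, Y 0 ω = y₀
  init_param : ∀ ω, Γ 0 ω = γ₀
  /-- Given the past, `Y_{n+1}` is drawn from `P_{Γ_n}(Y_n, ·)`. -/
  transition : ∀ n, ∀ B : Set 𝓨, MeasurableSet B →
    μ⟦Y (n + 1) ⁻¹' B | history Y Γ n⟧ =ᵐ[μ] fun ω => (P (Y n ω, Γ n ω)).real B
  /-- `Γ_n = U_n(Y_0, …, Y_n, Γ_0, …, Γ_{n-1})` for measurable update rules `U_n`. -/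
  update : ∃ U : (n : ℕ) → (Fin (n + 1) → 𝓨) × (Fin n → I) → I,
    (∀ n, Measurable (U n)) ∧
    ∀ n ω, Γ n ω = U n (fun i => Y i ω, fun i => Γ i ω)
  /-- The parameter is constant on `{T_j, …, T_{j+1} - 1}`. -/
  rare : ∀ j, ∀ i₁ ∈ Set.Ico (adaptTime β j) (adaptTime β (j + 1)),
    ∀ i₂ ∈ Set.Ico (adaptTime β j) (adaptTime β (j + 1)), Γ i₁ = Γ i₂

end Chain

end AIRMCMC

/-! Every `π γ` has first marginal `ν`, so `h` has the same mean `c = ν(f)` under all of them.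
Contraction makes `P_γ^n h - c` decay geometrically, uniformly in the state and in `γ`. Hence `g(y,
γ) = ∑ₙ (P_γ^n h(y) - c)` is bounded and solves the Poisson equation `g - P_γ g = h - c`
(`exists_poisson_solution`). Along the chain, `h(Y_j) - c` splits into `g(Y_{j+1}, Γ_j) - P_{Γ_j}
g(Y_j)`, which is centred given the past, and `g(Y_j, Γ_j) - g(Y_{j+1}, Γ_j)`.

The first terms are bounded martingale differences: Azuma–Hoeffding and Borel–Cantelli bound their
sum by `O(√(n log n))` almost surely (`ae_eventually_abs_sum_le`). The second would telescope if the
parameter were frozen. Each change of parameter costs `O(1)`, and `T_m ≥ m²/2` leaves only `O(√n)`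
changes up to time `n` (`abs_sum_sub_le`). Both sums are `o(√n (log n)^(1/2+ε))`. -/

namespace AIRMCMC

/-! ### Integrals of bounded functions against kernel powers -/

section KernelAverages

variable {A : Type*} [MeasurableSpace A]

instance isMarkovKernel_pow (κ : Kernel A A) [IsMarkovKernel κ] (n : ℕ) :
    IsMarkovKernel (κ ^ n) := by
  induction n with
  | zero => rw [pow_zero]; change IsMarkovKernel Kernel.id; infer_instance
  | succ n ih => rw [pow_succ]; change IsMarkovKernel (Kernel.comp (κ ^ n) κ); infer_instance

theorem integrable_of_abs_le {μ : Measure A} [IsFiniteMeasure μ] {ψ : A → ℝ} {C : ℝ}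
    (hψ : Measurable ψ) (hC : ∀ x, |ψ x| ≤ C) : Integrable ψ μ :=
  .of_bound hψ.aestronglyMeasurable C (.of_forall hC)

theorem abs_integral_le_of_abs_le {μ : Measure A} [IsProbabilityMeasure μ] {ψ : A → ℝ} {C : ℝ}
    (hC : ∀ x, |ψ x| ≤ C) : |∫ x, ψ x ∂μ| ≤ C := by
  simpa using norm_integral_le_of_norm_le_const (μ := μ) (f := ψ) (.of_forall hC)

theorem integral_kernel_mul {κ η : Kernel A A} [IsMarkovKernel κ] [IsMarkovKernel η] {ψ : A → ℝ}
    {C : ℝ} (hψ : Measurable ψ) (hC : ∀ x, |ψ x| ≤ C) (a : A) :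
    ∫ x, ψ x ∂(η * κ) a = ∫ y, ∫ x, ψ x ∂η y ∂κ a := by
  change ∫ x, ψ x ∂(η ∘ₖ κ) a = _
  exact Kernel.integral_comp (integrable_of_abs_le hψ hC)

theorem integral_kernel_pow_zero (κ : Kernel A A) {ψ : A → ℝ} (hψ : Measurable ψ) (a : A) :
    ∫ x, ψ x ∂(κ ^ 0) a = ψ a := by
  rw [pow_zero]
  change ∫ x, ψ x ∂Kernel.id a = _
  rw [Kernel.id_apply, integral_dirac' _ _ hψ.stronglyMeasurable]

theorem integral_kernel_pow_succ {κ : Kernel A A} [IsMarkovKernel κ] {ψ : A → ℝ}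
    {C : ℝ} (hψ : Measurable ψ) (hC : ∀ x, |ψ x| ≤ C) (n : ℕ) (a : A) :
    ∫ x, ψ x ∂(κ ^ (n + 1)) a = ∫ y, ∫ x, ψ x ∂(κ ^ n) y ∂κ a := by
  rw [pow_succ, integral_kernel_mul hψ hC]

theorem measurable_integral_kernel {κ : Kernel A A} {ψ : A → ℝ} (hψ : Measurable ψ) :
    Measurable fun a => ∫ x, ψ x ∂κ a :=
  hψ.stronglyMeasurable.integral_kernel.measurable

theorem integral_integral_of_invariant {κ : Kernel A A} [IsMarkovKernel κ] {π : Measure A}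
    [IsProbabilityMeasure π] (hπ : κ.Invariant π) {ψ : A → ℝ} {C : ℝ} (hψ : Measurable ψ)
    (hC : ∀ x, |ψ x| ≤ C) : ∫ y, ∫ x, ψ x ∂κ y ∂π = ∫ x, ψ x ∂π := by
  -- Viewing `π` as a constant kernel turns invariance into an identity of composed kernels.
  have h : κ ∘ₖ Kernel.const Unit π = Kernel.const Unit π := by
    rw [Kernel.comp_const κ π]; congr 1
  have := Kernel.integral_comp (η := κ) (κ := Kernel.const Unit π) (a := ()) (f := ψ)
    (integrable_of_abs_le hψ hC)
  rw [h] at this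
  simpa using this.symm

theorem integral_kernel_pow_of_invariant {κ : Kernel A A} [IsMarkovKernel κ] {π : Measure A}
    [IsProbabilityMeasure π] (hπ : κ.Invariant π) {ψ : A → ℝ} {C : ℝ} (hψ : Measurable ψ)
    (hC : ∀ x, |ψ x| ≤ C) (n : ℕ) : ∫ y, ∫ x, ψ x ∂(κ ^ n) y ∂π = ∫ x, ψ x ∂π := by
  induction n with
  | zero => simp_rw [integral_kernel_pow_zero κ hψ]
  | succ n ih =>
    simp_rw [integral_kernel_pow_succ hψ hC]
    rw [integral_integral_of_invariant hπ (measurable_integral_kernel hψ)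
      (fun x => abs_integral_le_of_abs_le hC), ih]

end KernelAverages

/-! ### Wasserstein contraction and geometric ergodicity -/

section Contraction

variable {A : Type*} [MeasurableSpace A] {d : A → A → ℝ≥0} {L : ℝ} {ψ : A → ℝ} {C : ℝ}

/-- The easy half of Kantorovich duality: under any coupling, the difference of the means is the
integral of `ψ p.1 - ψ p.2`. Boundedness of `ψ` supplies integrability, so no moment of `d` is
needed. -/
theorem IsLipschitzWrt.ofReal_abs_sub_le_wasserstein (hψ : Measurable ψ) (hC : ∀ x, |ψ x| ≤ C)
    (hL : 0 < L) (hlip : IsLipschitzWrt d L ψ) (μ₁ μ₂ : Measure A) [IsProbabilityMeasure μ₁]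
    [IsProbabilityMeasure μ₂] :
    ENNReal.ofReal |∫ x, ψ x ∂μ₁ - ∫ x, ψ x ∂μ₂| ≤ ENNReal.ofReal L * wasserstein d μ₁ μ₂ := by
  have hL' : ENNReal.ofReal L ≠ 0 := by simpa using hL
  rw [mul_comm, ← ENNReal.div_le_iff hL' ENNReal.ofReal_ne_top]
  refine le_iInf₂ fun ξ hξ => ?_
  obtain ⟨h₁, h₂⟩ := hξ
  rw [ENNReal.div_le_iff hL' ENNReal.ofReal_ne_top, mul_comm,
    ← lintegral_const_mul' _ _ ENNReal.ofReal_ne_top]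
  have hξ : IsProbabilityMeasure ξ := by
    have : IsProbabilityMeasure (ξ.map Prod.fst) := h₁ ▸ inferInstance
    exact Measure.isProbabilityMeasure_of_map Prod.fst
  rw [← h₁, ← h₂, integral_map measurable_fst.aemeasurable hψ.aestronglyMeasurable,
    integral_map measurable_snd.aemeasurable hψ.aestronglyMeasurable,
    ← integral_sub (integrable_of_abs_le (ψ := fun p : A × A => ψ p.1)
      (hψ.comp measurable_fst) fun x => hC _)
      (integrable_of_abs_le (ψ := fun p : A × A => ψ p.2)
      (hψ.comp measurable_snd) fun x => hC _),
    ← Real.enorm_eq_ofReal_abs]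
  refine (enorm_integral_le_lintegral_enorm _).trans (lintegral_mono fun p => ?_)
  rw [Real.enorm_eq_ofReal_abs, ← ENNReal.ofReal_coe_nnreal, ← ENNReal.ofReal_mul hL.le]
  exact ENNReal.ofReal_le_ofReal (hlip _ _)

theorem wasserstein_le_of_contractionCoeff_le (hd : ∀ x y, d x y = 0 ↔ x = y) {κ : Kernel A A}
    {c : ℝ≥0∞} (hc : contractionCoeff d κ ≤ c) {y₁ y₂ : A} (hy : y₁ ≠ y₂) :
    wasserstein d (κ y₁) (κ y₂) ≤ c * d y₁ y₂ := by
  have h : wasserstein d (κ y₁) (κ y₂) / (d y₁ y₂ : ℝ≥0∞) ≤ c :=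
    le_trans (le_iSup₂_of_le y₁ y₂ <|
      le_iSup (fun _ : y₁ ≠ y₂ => wasserstein d (κ y₁) (κ y₂) / (d y₁ y₂ : ℝ≥0∞)) hy) hc
  rwa [ENNReal.div_le_iff (by simpa [hd] using hy) ENNReal.coe_ne_top] at h

theorem IsLipschitzWrt.integral_kernel (hd : ∀ x y, d x y = 0 ↔ x = y) (hψ : Measurable ψ)
    (hC : ∀ x, |ψ x| ≤ C) (hL : 0 < L) (hlip : IsLipschitzWrt d L ψ) {κ : Kernel A A}
    [IsMarkovKernel κ] {c : ℝ} (hc₀ : 0 ≤ c) (hc : contractionCoeff d κ ≤ ENNReal.ofReal c) :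
    IsLipschitzWrt d (L * c) fun y => ∫ x, ψ x ∂κ y := by
  intro y₁ y₂
  have h0 : 0 ≤ L * c * (d y₁ y₂ : ℝ) := by positivity
  rcases eq_or_ne y₁ y₂ with rfl | hy
  · simpa using h0
  rw [← ENNReal.ofReal_le_ofReal_iff h0]
  refine (hlip.ofReal_abs_sub_le_wasserstein hψ hC hL _ _).trans ?_
  refine (mul_le_mul_right (wasserstein_le_of_contractionCoeff_le hd hc hy) _).trans ?_
  rw [ENNReal.ofReal_mul (by positivity), ENNReal.ofReal_mul hL.le, ENNReal.ofReal_coe_nnreal,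
    mul_assoc]

/-- Here `c` is strictly positive so that the Lipschitz constant stays positive through the
induction, as `integral_kernel` requires. -/
theorem IsLipschitzWrt.integral_kernel_pow (hd : ∀ x y, d x y = 0 ↔ x = y) (hψ : Measurable ψ)
    (hC : ∀ x, |ψ x| ≤ C) (hL : 0 < L) (hlip : IsLipschitzWrt d L ψ) {κ : Kernel A A}
    [IsMarkovKernel κ] {c : ℝ} (hc₀ : 0 < c) (hc : contractionCoeff d κ ≤ ENNReal.ofReal c)
    (n : ℕ) : IsLipschitzWrt d (L * c ^ n) fun y => ∫ x, ψ x ∂(κ ^ n) y := by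
  induction n with
  | zero =>
    simp_rw [integral_kernel_pow_zero κ hψ]
    simpa using hlip
  | succ n ih =>
    simp_rw [integral_kernel_pow_succ hψ hC]
    rw [pow_succ, ← mul_assoc]
    exact ih.integral_kernel hd (measurable_integral_kernel hψ)
      (fun x => abs_integral_le_of_abs_le hC) (by positivity) hc₀.le hc

theorem IsLipschitzWrt.abs_sub_integral_le (hψ : Measurable ψ) (hC : ∀ x, |ψ x| ≤ C)
    (hL : 0 ≤ L) (hlip : IsLipschitzWrt d L ψ) {π : Measure A} [IsProbabilityMeasure π] {y : A}
    {K : ℝ} (hK : 0 ≤ K) (hecc : eccentricity d π y ≤ ENNReal.ofReal K) :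
    |ψ y - ∫ x, ψ x ∂π| ≤ L * K := by
  rw [← ENNReal.ofReal_le_ofReal_iff (by positivity)]
  have h : ψ y - ∫ x, ψ x ∂π = ∫ x, (ψ y - ψ x) ∂π := by
    rw [integral_sub (integrable_const _) (integrable_of_abs_le hψ hC)]; simp
  rw [h, ← Real.enorm_eq_ofReal_abs, ENNReal.ofReal_mul hL]
  refine (enorm_integral_le_lintegral_enorm _).trans ?_
  refine le_trans ?_ (mul_le_mul_right hecc _)
  rw [eccentricity, ← lintegral_const_mul' _ _ ENNReal.ofReal_ne_top]
  refine lintegral_mono fun x => ?_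
  rw [Real.enorm_eq_ofReal_abs, ← ENNReal.ofReal_coe_nnreal, ← ENNReal.ofReal_mul hL]
  exact ENNReal.ofReal_le_ofReal (hlip _ _)

/-- Geometric ergodicity, tested against bounded Lipschitz functions. -/
theorem IsLipschitzWrt.abs_integral_kernel_pow_sub_le (hd : ∀ x y, d x y = 0 ↔ x = y)
    (hψ : Measurable ψ) (hC : ∀ x, |ψ x| ≤ C) (hL : 0 < L) (hlip : IsLipschitzWrt d L ψ)
    {κ : Kernel A A} [IsMarkovKernel κ] {π : Measure A} [IsProbabilityMeasure π]
    (hπ : κ.Invariant π) {M τ K : ℝ} (hM : 1 ≤ M) (hτ : 0 < τ) {k₀ : ℕ} (hk₀ : 1 ≤ k₀)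
    (h₁ : contractionCoeff d κ ≤ ENNReal.ofReal M)
    (h₂ : contractionCoeff d (κ ^ k₀) ≤ ENNReal.ofReal τ) (hK : 0 ≤ K) {y : A}
    (hecc : eccentricity d π y ≤ ENNReal.ofReal K) (n : ℕ) :
    |∫ x, ψ x ∂(κ ^ n) y - ∫ x, ψ x ∂π| ≤ L * M ^ k₀ * K * τ ^ (n / k₀) := by
  have hM0 : 0 < M := by linarith
  have hlip' : IsLipschitzWrt d (L * τ ^ (n / k₀) * M ^ (n % k₀))
      fun y => ∫ x, ψ x ∂(κ ^ n) y := by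
    -- Each complete block of `k₀` steps gains a factor `τ`; the remaining `n % k₀` steps lose at
    -- most `M ^ k₀`.
    have hn : κ ^ n = (κ ^ k₀) ^ (n / k₀) * κ ^ (n % k₀) := by
      rw [← pow_mul, ← pow_add, Nat.div_add_mod]
    simp_rw [hn, integral_kernel_mul hψ hC]
    exact (hlip.integral_kernel_pow hd hψ hC hL hτ h₂ _).integral_kernel_pow hd
      (measurable_integral_kernel hψ) (fun x => abs_integral_le_of_abs_le hC) (by positivity)
      hM0 h₁ _
  have h := hlip'.abs_sub_integral_le (measurable_integral_kernel hψ)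
    (fun x => abs_integral_le_of_abs_le hC) (by positivity) hK hecc
  rw [integral_kernel_pow_of_invariant hπ hψ hC] at h
  refine h.trans ?_
  have : M ^ (n % k₀) ≤ M ^ k₀ := pow_le_pow_right₀ hM (Nat.mod_lt _ hk₀).le
  calc L * τ ^ (n / k₀) * M ^ (n % k₀) * K ≤ L * τ ^ (n / k₀) * M ^ k₀ * K := by gcongr
    _ = _ := by ring

/-- Each power of `τ` occurs `k₀` times: Euclidean division turns the sum into a geometric series
times a finite sum. -/
theorem summable_pow_div {τ : ℝ} (hτ₀ : 0 ≤ τ) (hτ₁ : τ < 1) {k₀ : ℕ} (hk₀ : 1 ≤ k₀) :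
    Summable fun n : ℕ => τ ^ (n / k₀) := by
  have : NeZero k₀ := ⟨by omega⟩
  rw [← (Nat.divModEquiv k₀).symm.summable_iff]
  have h := (summable_geometric_of_lt_one hτ₀ hτ₁).mul_of_nonneg
    (g := fun _ : Fin k₀ => (1 : ℝ)) (Summable.of_finite) (fun _ => by positivity)
    (fun _ => zero_le_one)
  refine h.congr fun p => ?_
  have : (p.1 * k₀ + (p.2 : ℕ)) / k₀ = p.1 := by
    rw [Nat.mul_comm, Nat.mul_add_div (by omega), Nat.div_eq_of_lt p.2.2, add_zero]
  simp [Nat.divModEquiv, this]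

end Contraction

/-! ### The Poisson equation, jointly in state and parameter -/

section Poisson

variable {A I : Type*} [MeasurableSpace A] [MeasurableSpace I]

/-- The powers are taken separately for each parameter, so joint measurability is obtained by
peeling off the first step, an integral against the joint kernel `P`. -/
theorem measurable_integral_sectL_pow (P : Kernel (A × I) A) [IsMarkovKernel P] {ψ : A → ℝ} {C : ℝ}
    (hψ : Measurable ψ) (hC : ∀ x, |ψ x| ≤ C) (n : ℕ) :
    Measurable fun p : A × I => ∫ x, ψ x ∂(P.sectL p.2 ^ n) p.1 := by
  induction n with
  | zero =>
    simp_rw [integral_kernel_pow_zero _ hψ]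
    exact hψ.comp measurable_fst
  | succ n ih =>
    simp_rw [integral_kernel_pow_succ hψ hC, Kernel.sectL_apply]
    exact (StronglyMeasurable.integral_kernel_prod_right' (κ := P)
      (f := fun q : (A × I) × A => ∫ x, ψ x ∂(P.sectL q.1.2 ^ n) q.2)
      (ih.comp (measurable_snd.prodMk measurable_fst.snd)).stronglyMeasurable).measurable

/-- A bounded, jointly measurable solution of the Poisson equations of the kernels `P_γ`. -/
theorem exists_poisson_solution {d : A → A → ℝ≥0} (hd : ∀ x y, d x y = 0 ↔ x = y)
    (P : Kernel (A × I) A) [IsMarkovKernel P] (π : I → Measure A) [∀ γ, IsProbabilityMeasure (π γ)]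
    (hπ : ∀ γ, (P.sectL γ).Invariant (π γ)) {M τ K : ℝ} (hM : 1 ≤ M) (hτ₀ : 0 < τ) (hτ₁ : τ < 1)
    {k₀ : ℕ} (hk₀ : 1 ≤ k₀) (h₁ : ∀ γ, contractionCoeff d (P.sectL γ) ≤ ENNReal.ofReal M)
    (h₂ : ∀ γ, contractionCoeff d (P.sectL γ ^ k₀) ≤ ENNReal.ofReal τ) (hK : 0 ≤ K)
    (hecc : ∀ γ y, eccentricity d (π γ) y ≤ ENNReal.ofReal K) {ψ : A → ℝ} {C L c : ℝ}
    (hψ : Measurable ψ) (hC : ∀ x, |ψ x| ≤ C) (hL : 0 < L) (hlip : IsLipschitzWrt d L ψ)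
    (hc : ∀ γ, ∫ x, ψ x ∂π γ = c) :
    ∃ g : A × I → ℝ, Measurable g ∧ (∃ B, ∀ p, |g p| ≤ B) ∧
      ∀ p : A × I, g p - ∫ y, g (y, p.2) ∂P p = ψ p.1 - c := by
  let u : ℕ → A × I → ℝ := fun n p => ∫ x, ψ x ∂(P.sectL p.2 ^ n) p.1 - c
  have hu_meas : ∀ n, Measurable (u n) := fun n =>
    (measurable_integral_sectL_pow P hψ hC n).sub_const c
  -- One summable majorant for all states and parameters gives both the bound on `g` and dominated
  -- convergence.
  let a : ℕ → ℝ := fun n => L * M ^ k₀ * K * τ ^ (n / k₀)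
  have ha : Summable a := (summable_pow_div hτ₀.le hτ₁ hk₀).mul_left _
  have hua : ∀ n p, ‖u n p‖ ≤ a n := fun n p => by
    simpa [u, hc] using hlip.abs_integral_kernel_pow_sub_le hd hψ hC hL (hπ p.2) hM hτ₀ hk₀
      (h₁ p.2) (h₂ p.2) hK (hecc p.2 p.1) n
  have hsum : ∀ p, Summable fun n => u n p := fun p => .of_norm_bounded ha (hua · p)
  refine ⟨fun p => ∑' n, u n p, ?_, ⟨∑' n, a n, fun p =>
    tsum_of_norm_bounded ha.hasSum (hua · p)⟩, fun p => ?_⟩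
  · exact measurable_of_tendsto_metrizable
      (fun n => Finset.measurable_fun_sum (Finset.range n) fun k _ => hu_meas k)
      (tendsto_pi_nhds.2 fun p => (hsum p).hasSum.tendsto_sum_nat)
  -- Applying `P_γ` shifts the series by one index, so the difference leaves only the term `n = 0`.
  · have hstep : ∀ n, ∫ y, u n (y, p.2) ∂P p = u (n + 1) p := fun n => by
      have hp : P p = P.sectL p.2 p.1 := rfl
      simp only [u]
      rw [integral_kernel_pow_succ hψ hC, hp, integral_sub
        (integrable_of_abs_le (measurable_integral_kernel hψ)
          fun x => abs_integral_le_of_abs_le hC) (integrable_const _)]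
      simp
    have hint : HasSum (fun n => ∫ y, u n (y, p.2) ∂P p) (∫ y, ∑' n, u n (y, p.2) ∂P p) :=
      hasSum_integral_of_dominated_convergence (fun n _ => a n)
        (fun n => ((hu_meas n).comp measurable_prodMk_right).aestronglyMeasurable)
        (fun n => .of_forall fun y => hua n _) (.of_forall fun _ => ha) (integrable_const _)
        (.of_forall fun y => (hsum _).hasSum)
    simp_rw [hstep] at hint
    beta_reduce
    rw [← hint.tsum_eq, (hsum p).tsum_eq_zero_add, add_sub_cancel_right]
    simp only [u]
    rw [integral_kernel_pow_zero _ hψ]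

end Poisson

/-! ### Azuma–Hoeffding and Borel–Cantelli -/

section Martingale

variable {Ω : Type*} {m : MeasurableSpace Ω} {μ : Measure Ω} [IsProbabilityMeasure μ]

theorem integral_mul_eq_zero_of_condExp_eq_zero {m₀ : MeasurableSpace Ω} (hm : m₀ ≤ m)
    {Z D : Ω → ℝ} (hZ : StronglyMeasurable[m₀] Z) (hZD : Integrable (Z * D) μ)
    (hD : Integrable D μ) (h0 : μ[D | m₀] =ᵐ[μ] 0) : ∫ ω, Z ω * D ω ∂μ = 0 := by
  have h : μ[Z * D | m₀] =ᵐ[μ] 0 := by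
    filter_upwards [condExp_mul_of_stronglyMeasurable_left hZ hZD hD, h0] with ω h₁ h₂
    simp [h₁, h₂]
  have := integral_condExp (μ := μ) (f := Z * D) hm
  rw [integral_congr_ae h] at this
  simpa using this.symm

/-- By convexity the exponential lies below its chord on `[-B, B]`. The bound is kept linear in `x`
so that conditioning removes that term. -/
theorem exp_mul_le_exp_sq_add_mul {B x l : ℝ} (hB : 0 < B) (hx : |x| ≤ B) :
    Real.exp (l * x) ≤ Real.exp (l ^ 2 * B ^ 2 / 2) + Real.sinh (l * B) / B * x := by
  have hxB : |x / B| ≤ 1 := by rw [abs_div, abs_of_pos hB]; exact (div_le_one hB).2 hx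
  have h := Real.exp_mul_le_cosh_add_mul_sinh hxB (l * B)
  have h2 := Real.cosh_le_exp_half_sq (l * B)
  have e : x / B * (l * B) = l * x := by field_simp
  rw [e] at h
  calc _ ≤ _ := h
    _ ≤ Real.exp ((l * B) ^ 2 / 2) + x / B * Real.sinh (l * B) := by gcongr
    _ = _ := by rw [mul_pow]; ring

variable {ℱ : Filtration ℕ m} {D : ℕ → Ω → ℝ} {B : ℝ}

theorem stronglyMeasurable_sum_range (hD : ∀ n, StronglyMeasurable[ℱ (n + 1)] (D n)) (n : ℕ) :
    StronglyMeasurable[ℱ n] fun ω => ∑ k ∈ Finset.range n, D k ω :=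
  Finset.stronglyMeasurable_fun_sum _ fun k hk =>
    (hD k).mono (ℱ.mono (Finset.mem_range.1 hk))

theorem abs_sum_range_le (hB : ∀ n ω, |D n ω| ≤ B) (n : ℕ) (ω : Ω) :
    |∑ k ∈ Finset.range n, D k ω| ≤ n * B :=
  (Finset.abs_sum_le_sum_abs _ _).trans <|
    (Finset.sum_le_sum fun k _ => hB k ω).trans (by simp)

theorem integrable_exp_mul_sum (hD : ∀ n, StronglyMeasurable[ℱ (n + 1)] (D n))
    (hB : ∀ n ω, |D n ω| ≤ B) (l : ℝ) (n : ℕ) :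
    Integrable (fun ω => Real.exp (l * ∑ k ∈ Finset.range n, D k ω)) μ := by
  have hS : Measurable fun ω => ∑ k ∈ Finset.range n, D k ω :=
    ((stronglyMeasurable_sum_range hD n).mono (ℱ.le n)).measurable
  refine .of_bound (Real.measurable_exp.comp (hS.const_mul l)).aestronglyMeasurable
    (Real.exp (|l| * (n * B))) (.of_forall fun ω => ?_)
  rw [Real.norm_eq_abs, Real.abs_exp, Real.exp_le_exp]
  refine (le_abs_self _).trans ?_
  rw [abs_mul]
  exact mul_le_mul_of_nonneg_left (abs_sum_range_le hB n ω) (abs_nonneg _)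

/-- The Azuma–Hoeffding bound for the exponential moments of a martingale with bounded
increments. -/
theorem mgf_sum_le (hD : ∀ n, StronglyMeasurable[ℱ (n + 1)] (D n)) (hB0 : 0 < B)
    (hB : ∀ n ω, |D n ω| ≤ B) (h0 : ∀ n, μ[D n | ℱ n] =ᵐ[μ] 0) (l : ℝ) (n : ℕ) :
    mgf (fun ω => ∑ k ∈ Finset.range n, D k ω) μ l ≤ Real.exp (l ^ 2 * B ^ 2 / 2 * n) := by
  induction n with
  | zero => simp [mgf]
  | succ n ih =>
    set Z : Ω → ℝ := fun ω => Real.exp (l * ∑ k ∈ Finset.range n, D k ω)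
    have hZint : Integrable Z μ := integrable_exp_mul_sum hD hB l n
    have hZ : StronglyMeasurable[ℱ n] Z :=
      Real.continuous_exp.comp_stronglyMeasurable
        ((stronglyMeasurable_sum_range hD n).const_mul l)
    have hDm : AEStronglyMeasurable (D n) μ := ((hD n).mono (ℱ.le _)).aestronglyMeasurable
    have hZD : Integrable (Z * D n) μ :=
      hZint.mul_bdd hDm (.of_forall fun ω => hB n ω)
    have hDint : Integrable (D n) μ := .of_bound hDm B (.of_forall fun ω => hB n ω)
    have hzero := integral_mul_eq_zero_of_condExp_eq_zero (ℱ.le n) hZ hZD hDint (h0 n)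
    calc mgf (fun ω => ∑ k ∈ Finset.range (n + 1), D k ω) μ l
        ≤ ∫ ω, (Real.exp (l ^ 2 * B ^ 2 / 2) * Z ω
            + Real.sinh (l * B) / B * (Z ω * D n ω)) ∂μ := by
          refine integral_mono (integrable_exp_mul_sum hD hB l (n + 1))
            ((hZint.const_mul _).add (hZD.const_mul _)) fun ω => ?_
          have h := mul_le_mul_of_nonneg_left
            (exp_mul_le_exp_sq_add_mul (l := l) hB0 (hB n ω)) (Real.exp_pos
              (l * ∑ k ∈ Finset.range n, D k ω)).le
          simp only [Z, Finset.sum_range_succ, mul_add, Real.exp_add] at h ⊢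
          linarith
      _ = Real.exp (l ^ 2 * B ^ 2 / 2) * ∫ ω, Z ω ∂μ := by
          rw [integral_add (g := fun ω => Real.sinh (l * B) / B * (Z ω * D n ω))
            (hZint.const_mul _) (hZD.const_mul _), integral_const_mul,
            integral_const_mul, hzero, mul_zero, add_zero]
      _ ≤ Real.exp (l ^ 2 * B ^ 2 / 2) * Real.exp (l ^ 2 * B ^ 2 / 2 * n) := by
          gcongr; exact ih
      _ = _ := by rw [← Real.exp_add]; push_cast; ring_nf

theorem measureReal_sqrt_mul_log_le_sum_le (hD : ∀ n, StronglyMeasurable[ℱ (n + 1)] (D n))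
    (hB0 : 0 < B) (hB : ∀ n ω, |D n ω| ≤ B) (h0 : ∀ n, μ[D n | ℱ n] =ᵐ[μ] 0) (n : ℕ) :
    μ.real {ω | 2 * B * (√n * √(Real.log n)) ≤ ∑ k ∈ Finset.range n, D k ω} ≤
      Real.exp (-2 * Real.log n) := by
  have hlog : 0 ≤ Real.log n := Real.log_natCast_nonneg n
  -- This minimises the Chernoff exponent `-l t + l² B² n / 2` at `t = 2B √(n log n)`; the minimum
  -- is `-2 log n`, a summable tail.
  set l : ℝ := 2 / B * (√(Real.log n) / √n)
  refine (measure_ge_le_exp_mul_mgf _ (by positivity : 0 ≤ l)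
    (integrable_exp_mul_sum hD hB l n)).trans ?_
  refine (mul_le_mul_of_nonneg_left (mgf_sum_le hD hB0 hB h0 l n) (Real.exp_pos _).le).trans ?_
  rw [← Real.exp_add, Real.exp_le_exp]
  rcases Nat.eq_zero_or_pos n with rfl | hn
  · simp
  have hn' : (0 : ℝ) < √n := Real.sqrt_pos.2 (by exact_mod_cast hn)
  have e1 : -l * (2 * B * (√n * √(Real.log n))) = -4 * √(Real.log n) ^ 2 := by
    simp only [l]; field_simp; ring
  have e2 : l ^ 2 * B ^ 2 / 2 * √n ^ 2 = 2 * √(Real.log n) ^ 2 := by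
    simp only [l]; field_simp
  rw [Real.sq_sqrt (Nat.cast_nonneg n), Real.sq_sqrt hlog] at e2
  rw [Real.sq_sqrt hlog] at e1
  linarith

theorem summable_exp_neg_two_mul_log : Summable fun n : ℕ => Real.exp (-2 * Real.log n) := by
  -- The terms are `n⁻²` only for `n ≥ 1`; at `n = 0` the convention `log 0 = 0` gives `1`.
  rw [← summable_nat_add_iff 1]
  refine ((summable_nat_add_iff 1).2 (Real.summable_one_div_nat_pow.2 one_lt_two)).congr
    fun n => ?_
  have hn : (0 : ℝ) < (n + 1 : ℕ) := by positivity
  rw [mul_comm, ← Real.rpow_def_of_pos hn, Real.rpow_neg hn.le, one_div]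
  norm_cast

theorem ae_eventually_sum_le (hD : ∀ n, StronglyMeasurable[ℱ (n + 1)] (D n))
    (hB0 : 0 < B) (hB : ∀ n ω, |D n ω| ≤ B) (h0 : ∀ n, μ[D n | ℱ n] =ᵐ[μ] 0) :
    ∀ᵐ ω ∂μ, ∀ᶠ n : ℕ in atTop,
      ∑ k ∈ Finset.range n, D k ω ≤ 2 * B * (√n * √(Real.log n)) := by
  have hsum : ∑' n : ℕ, μ {ω | 2 * B * (√n * √(Real.log n)) ≤ ∑ k ∈ Finset.range n, D k ω}
      ≠ ∞ := by
    refine ne_top_of_le_ne_top summable_exp_neg_two_mul_log.tsum_ofReal_ne_top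
      (ENNReal.tsum_le_tsum fun n => ?_)
    rw [← ofReal_measureReal]
    exact ENNReal.ofReal_le_ofReal (measureReal_sqrt_mul_log_le_sum_le hD hB0 hB h0 n)
  filter_upwards [ae_eventually_notMem hsum] with ω hω
  filter_upwards [hω] with n hn
  exact (not_le.1 hn).le

/-- A martingale with bounded increments is eventually of order at most `√(n log n)`. -/
theorem ae_eventually_abs_sum_le (hD : ∀ n, StronglyMeasurable[ℱ (n + 1)] (D n))
    (hB0 : 0 < B) (hB : ∀ n ω, |D n ω| ≤ B) (h0 : ∀ n, μ[D n | ℱ n] =ᵐ[μ] 0) :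
    ∀ᵐ ω ∂μ, ∀ᶠ n : ℕ in atTop,
      |∑ k ∈ Finset.range n, D k ω| ≤ 2 * B * (√n * √(Real.log n)) := by
  have hneg : ∀ n, μ[-D n | ℱ n] =ᵐ[μ] 0 := fun n => by
    filter_upwards [condExp_neg (μ := μ) (D n) (ℱ n), h0 n] with ω h₁ h₂
    simp [h₁, h₂]
  filter_upwards [ae_eventually_sum_le hD hB0 hB h0,
    ae_eventually_sum_le (D := fun n => -D n) (fun n => (hD n).neg) hB0
      (fun n ω => by simpa using hB n ω) hneg] with ω h₁ h₂
  filter_upwards [h₁, h₂] with n h₁ h₂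
  simp only [Pi.neg_apply, Finset.sum_neg_distrib] at h₂
  exact abs_le.2 ⟨by linarith, h₁⟩

end Martingale

/-! ### Martingale increments of the chain -/

section History

variable {Ω 𝓨 I : Type*} [MeasurableSpace 𝓨] [MeasurableSpace I] {Y : ℕ → Ω → 𝓨} {Γ : ℕ → Ω → I}

theorem measurable_state_history {j n : ℕ} (hj : j ≤ n) : Measurable[history Y Γ n] (Y j) :=
  Measurable.mono (comap_measurable (Y j)) (le_sup_left.trans (le_iSup₂_of_le j hj le_rfl)) le_rfl

theorem measurable_param_history {j n : ℕ} (hj : j ≤ n) : Measurable[history Y Γ n] (Γ j) :=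
  Measurable.mono (comap_measurable (Γ j)) (le_sup_right.trans (le_iSup₂_of_le j hj le_rfl)) le_rfl

/-- The martingale increments attached to a function of the state and the parameter. -/
noncomputable def increment (P : Kernel (𝓨 × I) 𝓨) (g : 𝓨 × I → ℝ) (Y : ℕ → Ω → 𝓨)
    (Γ : ℕ → Ω → I) (n : ℕ) (ω : Ω) : ℝ :=
  g (Y (n + 1) ω, Γ n ω) - ∫ y, g (y, Γ n ω) ∂P (Y n ω, Γ n ω)

variable {P : Kernel (𝓨 × I) 𝓨} [IsMarkovKernel P] {g : 𝓨 × I → ℝ} {C : ℝ}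

theorem measurable_integral_section (hg : Measurable g) :
    Measurable fun p : 𝓨 × I => ∫ y, g (y, p.2) ∂P p :=
  (StronglyMeasurable.integral_kernel_prod_right' (κ := P)
    (f := fun q : (𝓨 × I) × 𝓨 => g (q.2, q.1.2))
    (hg.comp (measurable_snd.prodMk measurable_fst.snd)).stronglyMeasurable).measurable

theorem stronglyMeasurable_increment (hg : Measurable g) (n : ℕ) :
    StronglyMeasurable[history Y Γ (n + 1)] (increment P g Y Γ n) := by
  have h1 := hg.comp (Measurable.prodMk (measurable_state_history (Y := Y) (Γ := Γ)
    (le_refl (n + 1))) (measurable_param_history n.le_succ))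
  have h2 := (measurable_integral_section (P := P) hg).comp
    (Measurable.prodMk (measurable_state_history (Y := Y) (Γ := Γ)
    n.le_succ) (measurable_param_history n.le_succ))
  exact (Measurable.sub h1 h2).stronglyMeasurable

theorem abs_increment_le (hC : ∀ p, |g p| ≤ C) (n : ℕ) (ω : Ω) :
    |increment P g Y Γ n ω| ≤ 2 * C := by
  refine (abs_sub _ _).trans ?_
  have := abs_integral_le_of_abs_le (μ := P (Y n ω, Γ n ω)) (ψ := fun y => g (y, Γ n ω))
    fun y => hC _
  linarith [hC (Y (n + 1) ω, Γ n ω)]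

end History

/-! ### Conditional law of the next state -/

section Chain

variable {Ω 𝓨 I : Type*} [MeasurableSpace 𝓨] [MeasurableSpace I] [mΩ : MeasurableSpace Ω]
  {μ : Measure Ω} [IsProbabilityMeasure μ] {P : Kernel (𝓨 × I) 𝓨} [IsMarkovKernel P] {β : ℝ}
  {y₀ : 𝓨} {γ₀ : I} {Y : ℕ → Ω → 𝓨} {Γ : ℕ → Ω → I}

/-- The natural filtration of the chain. -/
def IsAIRChain.filtration (h : IsAIRChain μ P β y₀ γ₀ Y Γ) : Filtration ℕ mΩ where
  seq := history Y Γ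
  mono' _ _ hij := biSup_mono fun _ hk => hk.trans hij
  le' _ := iSup₂_le fun k _ =>
    sup_le (h.measurable_state k).comap_le (h.measurable_param k).comap_le

theorem IsAIRChain.measure_inter_preimage (h : IsAIRChain μ P β y₀ γ₀ Y Γ) {n : ℕ} {A : Set Ω}
    (hA : MeasurableSet[history Y Γ n] A) {B : Set 𝓨} (hB : MeasurableSet B) :
    μ (A ∩ Y (n + 1) ⁻¹' B) = ∫⁻ ω in A, P (Y n ω, Γ n ω) B ∂μ := by
  have hle : history Y Γ n ≤ mΩ := h.filtration.le n
  have hYB : MeasurableSet (Y (n + 1) ⁻¹' B) := h.measurable_state _ hB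
  have hW : Measurable fun ω => (Y n ω, Γ n ω) :=
    (h.measurable_state n).prodMk (h.measurable_param n)
  have hi : Integrable ((Y (n + 1) ⁻¹' B).indicator fun _ => (1 : ℝ)) μ :=
    (integrable_const _).indicator hYB
  have h1 := setIntegral_condExp (μ := μ) hle hi hA
  rw [setIntegral_congr_ae (hle _ hA) ((h.transition n B hB).mono fun ω hω _ => hω),
    integral_indicator_const _ hYB, measureReal_restrict_apply hYB] at h1
  have h2 := ofReal_integral_eq_lintegral_ofReal (μ := μ.restrict A)
    (f := fun ω => (P (Y n ω, Γ n ω)).real B)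
    (.of_bound ((P.measurable_coe hB).comp hW).ennreal_toReal.aestronglyMeasurable 1
      (.of_forall fun ω => by
        rw [Real.norm_of_nonneg measureReal_nonneg]; exact measureReal_le_one)) (.of_forall fun ω => measureReal_nonneg)
  have h3 : ∫⁻ ω in A, P (Y n ω, Γ n ω) B ∂μ =
      ∫⁻ ω in A, ENNReal.ofReal ((P (Y n ω, Γ n ω)).real B) ∂μ :=
    lintegral_congr fun ω => (ofReal_measureReal).symm
  rw [h3, ← h2, h1, smul_eq_mul, mul_one, ofReal_measureReal, Set.inter_comm]

/-- The joint law of the current state and parameter and of the next state, on an event of the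
past. -/
theorem IsAIRChain.map_restrict_eq_compProd (h : IsAIRChain μ P β y₀ γ₀ Y Γ) {n : ℕ} {A : Set Ω}
    (hA : MeasurableSet[history Y Γ n] A) :
    (μ.restrict A).map (fun ω => ((Y n ω, Γ n ω), Y (n + 1) ω)) =
      ((μ.restrict A).map fun ω => (Y n ω, Γ n ω)) ⊗ₘ P := by
  have hW : Measurable fun ω => (Y n ω, Γ n ω) :=
    (h.measurable_state n).prodMk (h.measurable_param n)
  have hWY := hW.prodMk (h.measurable_state (n + 1))
  have hle : history Y Γ n ≤ mΩ := h.filtration.le n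
  refine Measure.ext_prod fun {s t} hs ht => ?_
  -- The condition on `(Y n, Γ n)` is itself a past event and is absorbed into `A`.
  have hsA : MeasurableSet[history Y Γ n] ((fun ω => (Y n ω, Γ n ω)) ⁻¹' s ∩ A) :=
    MeasurableSet.inter ((Measurable.prodMk (measurable_state_history le_rfl)
      (measurable_param_history le_rfl)) hs) hA
  rw [Measure.map_apply hWY (hs.prod ht), Measure.restrict_apply (hWY (hs.prod ht)),
    Measure.compProd_apply_prod hs ht, setLIntegral_map hs (P.measurable_coe ht) hW,
    Measure.restrict_restrict (hW hs), ← h.measure_inter_preimage hsA ht]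
  congr 1
  ext ω
  simp only [Set.mem_inter_iff, Set.mem_preimage, Set.mem_prod]
  tauto

variable {g : 𝓨 × I → ℝ} {C : ℝ}

/-- On every past event the two parts of the increment have equal integrals, by the joint law.
Working with that law avoids exceptional null sets depending on `B`. -/
theorem IsAIRChain.condExp_increment (h : IsAIRChain μ P β y₀ γ₀ Y Γ) (hg : Measurable g)
    (hC : ∀ p, |g p| ≤ C) (n : ℕ) : μ[increment P g Y Γ n | history Y Γ n] =ᵐ[μ] 0 := by
  have hle : history Y Γ n ≤ mΩ := h.filtration.le n
  have hW : Measurable fun ω => (Y n ω, Γ n ω) :=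
    (h.measurable_state n).prodMk (h.measurable_param n)
  have hWY := hW.prodMk (h.measurable_state (n + 1))
  have hG : Measurable fun q : (𝓨 × I) × 𝓨 => g (q.2, q.1.2) :=
    hg.comp (measurable_snd.prodMk measurable_fst.snd)
  have hPg := measurable_integral_section (P := P) hg
  have hPC : ∀ p : 𝓨 × I, |∫ y, g (y, p.2) ∂P p| ≤ C := fun p =>
    abs_integral_le_of_abs_le fun y => hC _
  have hint : Integrable (increment P g Y Γ n) μ :=
    integrable_of_abs_le (((stronglyMeasurable_increment hg n).mono
      (h.filtration.le _)).measurable) (abs_increment_le hC n)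
  refine (ae_eq_condExp_of_forall_setIntegral_eq hle hint (fun _ _ _ => integrableOn_zero)
    (fun A hA _ => ?_) aestronglyMeasurable_zero).symm
  have h1 : ∫ ω in A, g (Y (n + 1) ω, Γ n ω) ∂μ =
      ∫ ω in A, ∫ y, g (y, Γ n ω) ∂P (Y n ω, Γ n ω) ∂μ := by
    have e1 := integral_map (μ := μ.restrict A) hWY.aemeasurable hG.aestronglyMeasurable
    have e2 := integral_map (μ := μ.restrict A) hW.aemeasurable hPg.aestronglyMeasurable
    rw [h.map_restrict_eq_compProd hA, Measure.integral_compProd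
      (integrable_of_abs_le hG fun q => hC _)] at e1
    rw [← e1, ← e2]
  have i1 : Integrable (fun ω => g (Y (n + 1) ω, Γ n ω)) (μ.restrict A) :=
    integrable_of_abs_le (hG.comp hWY) fun ω => hC _
  have i2 : Integrable (fun ω => ∫ y, g (y, Γ n ω) ∂P (Y n ω, Γ n ω)) (μ.restrict A) :=
    integrable_of_abs_le (hPg.comp hW) fun ω => hPC _
  simp only [increment]
  rw [integral_sub i1 i2, h1, sub_self]
  simp

end Chain

/-! ### Counting parameter changes -/

section Windows

variable {β : ℝ}

theorem adaptTime_succ (β : ℝ) (m : ℕ) :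
    adaptTime β (m + 1) = adaptTime β m + windowLength β (m + 1) :=
  Finset.sum_Icc_succ_top (by omega) _

theorem le_windowLength (hβ : 1 ≤ β) {j : ℕ} (hj : 1 ≤ j) : j ≤ windowLength β j := by
  have h : (j : ℝ) ≤ (j : ℝ) ^ β := Real.self_le_rpow_of_one_le (by exact_mod_cast hj) hβ
  exact_mod_cast h.trans (Nat.le_ceil _)

/-- As `k_j ≥ j`, the time `T_m` is at least `1 + ⋯ + m`. -/
theorem sq_le_two_mul_adaptTime (hβ : 1 ≤ β) (m : ℕ) : m ^ 2 ≤ 2 * adaptTime β m := by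
  induction m with
  | zero => simp
  | succ m ih =>
    have := le_windowLength hβ (Nat.le_add_left 1 m)
    rw [adaptTime_succ]
    nlinarith

theorem exists_adaptTime_eq_or_eq {I : Type*} (hβ : 1 ≤ β) {Γ : ℕ → I}
    (hΓ : ∀ j, ∀ i₁ ∈ Set.Ico (adaptTime β j) (adaptTime β (j + 1)),
      ∀ i₂ ∈ Set.Ico (adaptTime β j) (adaptTime β (j + 1)), Γ i₁ = Γ i₂) (j : ℕ) :
    (∃ m, adaptTime β m = j + 1) ∨ Γ j = Γ (j + 1) := by
  classical
  have hex : ∃ m, j < adaptTime β m := ⟨2 * (j + 1), by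
    have := sq_le_two_mul_adaptTime hβ (2 * (j + 1))
    nlinarith⟩
  obtain ⟨m, hm⟩ : ∃ m, Nat.find hex = m + 1 := Nat.exists_eq_succ_of_ne_zero fun h0 => by
    have := Nat.find_spec hex
    rw [h0] at this
    simp [adaptTime] at this
  have hlt : j < adaptTime β (m + 1) := hm ▸ Nat.find_spec hex
  have hle : adaptTime β m ≤ j := not_lt.1 (Nat.find_min hex (by omega))
  rcases Nat.lt_or_ge (j + 1) (adaptTime β (m + 1)) with h | h
  · exact .inr (hΓ m j ⟨hle, hlt⟩ (j + 1) ⟨by omega, h⟩)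
  · exact .inl ⟨m + 1, by omega⟩

/-- A change between `j` and `j + 1` forces `j + 1 = T_m`, and then `m² ≤ 2 T_m ≤ 2n`; the extra `1`
allows for `m = 0`. -/
theorem card_filter_ne_succ_le {I : Type*} [DecidableEq I] (hβ : 1 ≤ β) {Γ : ℕ → I}
    (hΓ : ∀ j, ∀ i₁ ∈ Set.Ico (adaptTime β j) (adaptTime β (j + 1)),
      ∀ i₂ ∈ Set.Ico (adaptTime β j) (adaptTime β (j + 1)), Γ i₁ = Γ i₂) (n : ℕ) :
    ((Finset.range n).filter fun j => Γ j ≠ Γ (j + 1)).card ≤ Nat.sqrt (2 * n) + 1 := by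
  have hsub : ((Finset.range n).filter fun j => Γ j ≠ Γ (j + 1)).image (· + 1) ⊆
      (Finset.range (Nat.sqrt (2 * n) + 1)).image (adaptTime β) := by
    intro i hi
    obtain ⟨j, hj, rfl⟩ := Finset.mem_image.1 hi
    obtain ⟨hjn, hne⟩ := Finset.mem_filter.1 hj
    obtain ⟨m, hm⟩ := (exists_adaptTime_eq_or_eq hβ hΓ j).resolve_right hne
    refine Finset.mem_image.2 ⟨m, Finset.mem_range.2 (Nat.lt_succ_of_le (Nat.le_sqrt'.2 ?_)), hm⟩
    have := sq_le_two_mul_adaptTime hβ m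
    have := Finset.mem_range.1 hjn
    omega
  rw [← Finset.card_image_of_injective _ (add_left_injective 1)]
  exact (Finset.card_le_card hsub).trans (Finset.card_image_le.trans (by simp))

/-- Freezing the parameter on the windows makes the drift of `g` along the path small. -/
theorem abs_sum_sub_le {A I : Type*} (hβ : 1 ≤ β) {y : ℕ → A} {Γ : ℕ → I}
    (hΓ : ∀ j, ∀ i₁ ∈ Set.Ico (adaptTime β j) (adaptTime β (j + 1)),
      ∀ i₂ ∈ Set.Ico (adaptTime β j) (adaptTime β (j + 1)), Γ i₁ = Γ i₂)
    {g : A × I → ℝ} {C : ℝ} (hC : ∀ p, |g p| ≤ C) (n : ℕ) :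
    |∑ j ∈ Finset.range n, (g (y j, Γ j) - g (y (j + 1), Γ j))| ≤
      2 * C * (√(2 * n) + 2) := by
  classical
  have hsub : ∀ p q, |g p - g q| ≤ 2 * C := fun p q => by
    linarith [abs_sub (g p) (g q), hC p, hC q]
  have hC0 : 0 ≤ 2 * C := (abs_nonneg _).trans (hsub (y 0, Γ 0) (y 0, Γ 0))
  -- Inserting `g (y (j + 1), Γ (j + 1))` separates a telescoping sum from terms that vanish unless
  -- the parameter changes.
  have hsplit : ∑ j ∈ Finset.range n, (g (y j, Γ j) - g (y (j + 1), Γ j)) =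
      (g (y 0, Γ 0) - g (y n, Γ n)) +
        ∑ j ∈ Finset.range n, (g (y (j + 1), Γ (j + 1)) - g (y (j + 1), Γ j)) := by
    rw [← Finset.sum_range_sub' (fun j => g (y j, Γ j)), ← Finset.sum_add_distrib]
    exact Finset.sum_congr rfl fun j _ => by ring
  have hjump : |∑ j ∈ Finset.range n, (g (y (j + 1), Γ (j + 1)) - g (y (j + 1), Γ j))| ≤
      2 * C * (√(2 * n) + 1) := by
    rw [← Finset.sum_filter_of_ne (p := fun j => Γ j ≠ Γ (j + 1))
      fun j _ h0 h => h0 (by rw [h, sub_self])]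
    refine (Finset.abs_sum_le_sum_abs _ _).trans
      ((Finset.sum_le_card_nsmul _ _ (2 * C) fun j _ => hsub _ _).trans ?_)
    rw [nsmul_eq_mul, mul_comm]
    refine mul_le_mul_of_nonneg_left ?_ hC0
    have h1 : ((Nat.sqrt (2 * n) + 1 : ℕ) : ℝ) ≤ √(2 * n) + 1 := by
      have := Real.nat_sqrt_le_real_sqrt (a := 2 * n)
      push_cast at this ⊢
      linarith
    exact le_trans (by exact_mod_cast card_filter_ne_succ_le hβ hΓ n) h1
  rw [hsplit]
  refine (abs_add_le _ _).trans ?_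
  linarith [hsub (y 0, Γ 0) (y n, Γ n)]

end Windows

/-! ### Normalisation and the law of large numbers -/

theorem tendsto_div_sqrt_mul_log_rpow {s : ℕ → ℝ} {K ε : ℝ} (hε : 0 < ε)
    (hs : ∀ᶠ n : ℕ in atTop, |s n| ≤ K * (√n * √(Real.log n))) :
    Tendsto (fun n : ℕ => s n / (√n * Real.log n ^ (1 / 2 + ε))) atTop (𝓝 0) := by
  have hlog : Tendsto (fun n : ℕ => Real.log n) atTop atTop :=
    Real.tendsto_log_atTop.comp tendsto_natCast_atTop_atTop
  have hlim : Tendsto (fun n : ℕ => K * Real.log n ^ (-ε)) atTop (𝓝 0) := by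
    simpa using ((tendsto_rpow_neg_atTop hε).comp hlog).const_mul K
  refine squeeze_zero_norm' ?_ hlim
  filter_upwards [hs, hlog.eventually_gt_atTop 0, eventually_gt_atTop 0] with n hn hl hn0
  have hn' : (0 : ℝ) < √n := Real.sqrt_pos.2 (by exact_mod_cast hn0)
  have hp := Real.rpow_pos_of_pos hl (1 / 2 + ε)
  rw [Real.norm_eq_abs, abs_div, abs_of_pos (mul_pos hn' hp), div_le_iff₀ (mul_pos hn' hp)]
  refine hn.trans_eq ?_
  have : √(Real.log n) = Real.log n ^ (-ε) * Real.log n ^ (1 / 2 + ε) := by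
    rw [← Real.rpow_add hl, Real.sqrt_eq_rpow]; ring_nf
  rw [this]; ring

section LawOfLargeNumbers

variable {Ω 𝓨 I : Type*} [MeasurableSpace 𝓨] [MeasurableSpace I] [mΩ : MeasurableSpace Ω]
  {μ : Measure Ω} [IsProbabilityMeasure μ] {P : Kernel (𝓨 × I) 𝓨} [IsMarkovKernel P] {β : ℝ}
  {y₀ : 𝓨} {γ₀ : I} {Y : ℕ → Ω → 𝓨} {Γ : ℕ → Ω → I}

/-- The constant adds `4C` from the martingale, `8C` from the drift and `4C` from the boundary
terms. -/
theorem IsAIRChain.ae_eventually_abs_sum_le (h : IsAIRChain μ P β y₀ γ₀ Y Γ) (hβ : 1 ≤ β)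
    {g : 𝓨 × I → ℝ} {C : ℝ} (hg : Measurable g) (hC : ∀ p, |g p| ≤ C) (hC0 : 0 < C)
    {φ : 𝓨 → ℝ} (hφ : ∀ p : 𝓨 × I, g p - ∫ y, g (y, p.2) ∂P p = φ p.1) :
    ∀ᵐ ω ∂μ, ∀ᶠ n : ℕ in atTop,
      |∑ j ∈ Finset.Icc 1 n, φ (Y j ω)| ≤ 16 * C * (√n * √(Real.log n)) := by
  have hmart := AIRMCMC.ae_eventually_abs_sum_le (ℱ := h.filtration) (D := increment P g Y Γ)
    (fun n => stronglyMeasurable_increment hg n) (by positivity : 0 < 2 * C)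
    (abs_increment_le hC) (h.condExp_increment hg hC)
  -- Once `log n ≥ 1`, constants and multiples of `√n` are absorbed into `√n √(log n)`.
  have hlog : ∀ᶠ n : ℕ in atTop, 1 ≤ Real.log n :=
    (Real.tendsto_log_atTop.comp tendsto_natCast_atTop_atTop).eventually_ge_atTop 1
  filter_upwards [hmart] with ω hω
  filter_upwards [hω, hlog, eventually_ge_atTop 1] with n hn hl hn1
  have hφb : ∀ j, |φ (Y j ω)| ≤ 2 * C := fun j => by
    rw [← hφ (Y j ω, Γ j ω)]
    have h1 := abs_sub (g (Y j ω, Γ j ω)) (∫ y, g (y, Γ j ω) ∂P (Y j ω, Γ j ω))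
    have h2 := abs_integral_le_of_abs_le (μ := P (Y j ω, Γ j ω)) (ψ := fun y => g (y, Γ j ω))
      fun y => hC _
    linarith [hC (Y j ω, Γ j ω)]
  -- The decomposition runs over `0, …, n - 1`; shifting to `1, …, n` costs `φ (Y n ω) - φ (Y 0 ω)`.
  have hsum : ∑ j ∈ Finset.Icc 1 n, φ (Y j ω) =
      (φ (Y n ω) - φ (Y 0 ω)) + ∑ j ∈ Finset.range n, increment P g Y Γ j ω +
        ∑ j ∈ Finset.range n, (g (Y j ω, Γ j ω) - g (Y (j + 1) ω, Γ j ω)) := by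
    have h1 : ∑ j ∈ Finset.Icc 1 n, φ (Y j ω) = ∑ j ∈ Finset.range n, φ (Y (j + 1) ω) := by
      rw [Finset.range_eq_Ico, Finset.sum_Ico_add' (fun j => φ (Y j ω)) 0 n 1]
      rfl
    rw [h1, ← Finset.sum_range_sub (fun j => φ (Y j ω)), ← Finset.sum_add_distrib,
      ← Finset.sum_add_distrib]
    refine Finset.sum_congr rfl fun j _ => ?_
    have := hφ (Y j ω, Γ j ω)
    simp only [increment] at this ⊢
    linarith
  have hdrift := abs_sum_sub_le hβ (y := fun j => Y j ω) (Γ := fun j => Γ j ω)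
    (fun j i₁ h₁ i₂ h₂ => congrFun (h.rare j i₁ h₁ i₂ h₂) ω) hC n
  have hsqrt1 : 1 ≤ √(n : ℝ) := Real.one_le_sqrt.2 (by exact_mod_cast hn1)
  have hsqrtlog : 1 ≤ √(Real.log n) := Real.one_le_sqrt.2 hl
  have hsqrt2 : √(2 * n : ℝ) ≤ 2 * √(n : ℝ) := by
    rw [Real.sqrt_mul zero_le_two]
    gcongr
    exact (Real.sqrt_le_left zero_le_two).2 (by norm_num)
  have hle : √(n : ℝ) ≤ √n * √(Real.log n) := le_mul_of_one_le_right (by positivity) hsqrtlog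
  rw [hsum]
  have hfirst := abs_sub (φ (Y n ω)) (φ (Y 0 ω))
  refine (abs_add_le _ _).trans ((add_le_add_left (abs_add_le _ _) _).trans ?_)
  have := hφb n
  have := hφb 0
  set r := √(n : ℝ) * √(Real.log n)
  have e1 : 2 * C * (√(2 * n : ℝ) + 2) ≤ 2 * C * (2 * r + 2 * r) := by
    gcongr <;> linarith
  have e2 : C * 1 ≤ C * r := by gcongr; linarith
  linarith

end LawOfLargeNumbers

end AIRMCMC

theorem mainTheorem1
    {X Φ I Ω : Type*}
    [MeasurableSpace X] [MeasurableSpace Φ] [MeasurableSpace I] [MeasurableSpace Ω]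
    [TopologicalSpace (X × Φ)] [PolishSpace (X × Φ)] [OpensMeasurableSpace (X × Φ)]
    (μ : Measure Ω) [IsProbabilityMeasure μ]
    -- the target, the transition kernels and their invariant distributions
    (ν : Measure X) [IsProbabilityMeasure ν]
    (P : Kernel ((X × Φ) × I) (X × Φ)) [IsMarkovKernel P]
    (π : I → Measure (X × Φ)) [∀ γ, IsProbabilityMeasure (π γ)]
    (hmarginal : ∀ γ, (π γ).map Prod.fst = ν)
    (hinvariant : ∀ γ, (P.sectL γ).Invariant (π γ))
    -- the AIR chain
    (β : ℝ) (hβ : 1 ≤ β)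
    (y₀ : X × Φ) (γ₀ : I) (Y : ℕ → Ω → X × Φ) (Γ : ℕ → Ω → I)
    (hchain : AIRMCMC.IsAIRChain μ P β y₀ γ₀ Y Γ)
    -- the distance-like function and the uniform contraction
    (d : X × Φ → X × Φ → ℝ≥0) (hd : AIRMCMC.IsDistanceLike d)
    (M τ : ℝ) (hM : 1 ≤ M) (hτ₀ : 0 ≤ τ) (hτ₁ : τ < 1) (k₀ : ℕ) (hk₀ : 1 ≤ k₀)
    (hcontr₁ : ∀ γ, AIRMCMC.contractionCoeff d (P.sectL γ) ≤ ENNReal.ofReal M)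
    (hcontr₂ : ∀ γ, AIRMCMC.contractionCoeff d (P.sectL γ ^ k₀) ≤ ENNReal.ofReal τ)
    -- uniformly bounded eccentricities
    (K : ℝ) (hK : 0 < K)
    (hecc : ∀ γ y, AIRMCMC.eccentricity d (π γ) y ≤ ENNReal.ofReal K)
    -- the integrand, with `h (x, φ) = f x`
    (f : X → ℝ) (hf : Measurable f)
    (hbdd : ∃ C : ℝ, ∀ y : X × Φ, |f y.1| ≤ C)
    (hlip : ∃ L : ℝ, 0 < L ∧ AIRMCMC.IsLipschitzWrt d L (fun y : X × Φ => f y.1)) :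
    ∀ ε : ℝ, 0 < ε → ∀ᵐ ω ∂μ,
      Tendsto
        (fun n : ℕ => (∑ j ∈ Finset.Icc 1 n, (f (Y j ω).1 - ∫ x, f x ∂ν)) /
          (Real.sqrt n * Real.log n ^ (1 / 2 + ε)))
        atTop (𝓝 0) := by
  intro ε hε
  obtain ⟨C, hC⟩ := hbdd
  obtain ⟨L, hL, hlip⟩ := hlip
  have hf' : Measurable fun y : X × Φ => f y.1 := hf.comp measurable_fst
  have hmean : ∀ γ, ∫ y, f y.1 ∂π γ = ∫ x, f x ∂ν := fun γ => by
    rw [← hmarginal γ, integral_map measurable_fst.aemeasurable hf.aestronglyMeasurable]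
  -- `τ` may be zero; `(τ + 1) / 2` is a larger rate strictly between `0` and `1`.
  obtain ⟨g, hg, ⟨B, hB⟩, hpoisson⟩ := AIRMCMC.exists_poisson_solution hd.eq_zero_iff P π
    hinvariant hM (τ := (τ + 1) / 2) (by linarith) (by linarith) hk₀ hcontr₁
    (fun γ => (hcontr₂ γ).trans (ENNReal.ofReal_le_ofReal (by linarith))) hK.le hecc hf' hC hL
    hlip hmean
  -- The bound `|B| + 1` is used because it is positive.
  filter_upwards [hchain.ae_eventually_abs_sum_le hβ hg
    (fun p => (hB p).trans ((le_abs_self B).trans (le_add_of_nonneg_right zero_le_one)))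
    (by positivity) (φ := fun y => f y.1 - ∫ x, f x ∂ν) hpoisson] with ω hω
  exact AIRMCMC.tendsto_div_sqrt_mul_log_rpow hε hω
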